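/- Throughout, $\mathbb N=\{1,2,\dots\}$, $\log$ is the natural logarithm, a pdf is an a.e. non-negative function with Lebesgue integral one, equalities of functions are meant almost everywhere, and $\mathcal D_d$ is the set of all pdfs on $\mathbb R^d$ supported on $[0,1]^d$. A pdf $p$ on $\mathbb R^d$ has NL-spectrum $(w,L)$, with $w=(w_i)_{i\ge1}$ and $L=(L_i)_{i\ge1}$, if $$p(x_1,\dots,x_d)=\sum_{i=1}^\infty w_i\prod_{j=1}^d p_{i,j}(x_j),$$ where $w_i\ge 0$, $w_1>0$, $\sum_{i=1}^\infty w_i=1$, and each $p_{i,j}$ ($i\ge 1$, $1\le j\le d$) is a pdf on $\mathbb R$ that is $L_i$-Lipschitz on $\mathbb R$. Let $\mathcal H_{1,b}$ be the set of pdfs $\sum_{i=1}^b a_i\mathbf 1_{[(i-1)/b,\,i/b)}$ with $a_i\ge0$, and let $\mathcal H_{d,b}^k$ be the set of low-rank histograms $\sum_{i=1}^k v_i\prod_{j=1}^d h_{i,j}(x_j)$ with $v_i\ge 0$, $\sum_{i=1}^k v_i=1$ and $h_{i,j}\in\mathcal H_{1,b}$. Theorem. Let $d,b,k,n\in\mathbb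 N$ and $0<\delta\le1$. There exists an estimator $V_n$, that is, a measurable function of $n$ sample points in $\mathbb R^d$ depending only on $d,b,k,n,\delta$, with values in $\mathcal D_d$, more precisely in $\mathcal H_{d,b}^k$, such that for every $p\in\mathcal D_d$ with NL-spectrum $(w,L)$, if $X_1,\dots,X_n$ are iid with density $p$ and $V_n=V_n(X_1,\dots,X_n)$, then $$P\left(\|p-V_n\|_1>\frac{\sqrt3\,d}{2b}\sum_{i=1}^k w_iL_i+6\sum_{i=k+1}^\infty w_i+7\sqrt{\frac{2bdk\log(4bdkn)}{n}}+7\sqrt{\frac{\log(3/\delta)}{2n}}\right)<\delta .$$ -/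

import Mathlib

open MeasureTheory ProbabilityTheory
open scoped NNReal

noncomputable section

/-- A probability density function with respect to Lebesgue measure: an integrable, almost
everywhere non-negative function with integral one. -/
structure IsPdf {E : Type*} [MeasureSpace E] (f : E → ℝ) : Prop where
  integrable : Integrable f
  nonneg : ∀ᵐ x, 0 ≤ f x
  integral_eq_one : ∫ x, f x = 1

/-- The set of all probability density functions on `ℝ ^ d` supported on the unit cube
`[0, 1] ^ d` (functions are considered up to almost everywhere equality, so the support condition
is an almost everywhere condition). -/
def unitCubePdfs (d : ℕ) : Set ((Fin d → ℝ) → ℝ) :=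
  {p | IsPdf p ∧ ∀ᵐ x : Fin d → ℝ, x ∉ Set.Icc (0 : Fin d → ℝ) 1 → p x = 0}

/-- The probability measure on `ℝ ^ d` with Lebesgue density `p`. -/
def densityMeasure {d : ℕ} (p : (Fin d → ℝ) → ℝ) : Measure (Fin d → ℝ) :=
  volume.withDensity fun x => ENNReal.ofReal (p x)

/-- `(w, L)` is a non-negative Lipschitz spectrum of `p`: almost everywhere,
`p (x₁, …, x_d) = ∑ᵢ wᵢ ∏ⱼ qᵢⱼ (xⱼ)`, where `w` is a non-negative sequence of sum one with positive
first entry and each `qᵢⱼ` is an `Lᵢ`-Lipschitz probability density function on `ℝ`.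
The sequences are indexed from `0`. -/
def HasNLSpectrum {d : ℕ} (p : (Fin d → ℝ) → ℝ) (w : ℕ → ℝ) (L : ℕ → ℝ≥0) : Prop :=
  (∀ i, 0 ≤ w i) ∧ 0 < w 0 ∧ HasSum w 1 ∧
    ∃ q : ℕ → Fin d → ℝ → ℝ,
      (∀ i j, IsPdf (q i j) ∧ LipschitzWith (L i) (q i j)) ∧
      ∀ᵐ x : Fin d → ℝ, HasSum (fun i => w i * ∏ j, q i j (x j)) (p x)

/-- Histograms on `[0, 1]` with `b` bins of equal width: non-negative combinations of the
indicators of the intervals `[i / b, (i + 1) / b)`, `0 ≤ i < b`, with integral one. -/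
def histograms (b : ℕ) : Set (ℝ → ℝ) :=
  {h | ∃ a : Fin b → ℝ, (∀ i, 0 ≤ a i) ∧
    (h = fun t => ∑ i : Fin b,
      a i * (Set.Ico ((i : ℝ) / b) (((i : ℝ) + 1) / b)).indicator (fun _ => (1 : ℝ)) t) ∧
    ∫ t, h t = 1}

/-- Low-rank histograms on `[0, 1] ^ d` with `b` bins per dimension: convex combinations of `k`
products of one-dimensional histograms. -/
def lowRankHistograms (d b k : ℕ) : Set ((Fin d → ℝ) → ℝ) :=
  {f | ∃ (v : Fin k → ℝ) (h : Fin k → Fin d → ℝ → ℝ),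
    (∀ i, 0 ≤ v i) ∧ ∑ i, v i = 1 ∧ (∀ i j, h i j ∈ histograms b) ∧
    f = fun x => ∑ i, v i * ∏ j, h i j (x j)}

end

open MeasureTheory ProbabilityTheory
open scoped NNReal

/-! The estimator is a minimum distance (Yatracos) selection from a finite family: the low-rank
histograms whose weights and bin probabilities are multiples of `1 / m`.

Selection: if `t` bounds the error of the empirical measure on all sets `{q j < q i}`, the selected
density is within `3 ‖p - q c‖₁ + 4 t` of `p` for every candidate `c`
(`integral_abs_sub_le_of_minimum_distance`). Hoeffding's inequality and a union bound over pairs of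
candidates control `t` (`exists_measurable_selector`).

Approximation (`exists_gridMixture_integral_abs_sub_le`): cutting the mixture after `k` terms costs
the tail mass, and giving that mass back to one component costs it again. Replacing each factor of
component `i` by its bin averages costs `L i / (√12 b)`, because an `L`-Lipschitz function has
variance at most `L² h² / 12` on an interval of length `h`; these costs add over the `d`
coordinates. Rounding to the grid costs `(2bd + 2k) / m`.

With `m + 1 = 4bdkn` the family has at most `exp (2bdk log (4bdkn))` members. For the two square
roots `r₁`, `r₂` of the statement, `t = r₁ + r₂` absorbs the union bound and `r₁` dominates the
rounding error, so the total stochastic term is at most `3 r₁ + 4 (r₁ + r₂)`. -/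

noncomputable section

/-! ### Minimum distance estimation over Yatracos sets -/

section MinimumDistance

variable {E : Type*} [MeasureSpace E]

lemma integral_abs_sub_le_add {f g h : E → ℝ} (hf : Integrable f) (hg : Integrable g)
    (hh : Integrable h) :
    ∫ x, |f x - h x| ≤ (∫ x, |f x - g x|) + ∫ x, |g x - h x| := by
  have hfg : Integrable fun x => |f x - g x| := (hf.sub hg).abs
  have hgh : Integrable fun x => |g x - h x| := (hg.sub hh).abs
  have hfh : Integrable fun x => |f x - h x| := (hf.sub hh).abs
  rw [← integral_add hfg hgh]
  exact integral_mono hfh (hfg.add hgh) fun x => abs_sub_le _ _ _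

/-- The integrals over `A` and its complement are opposite, so each accounts for at most half of the
`L¹` norm. -/
lemma two_mul_abs_setIntegral_le {u : E → ℝ} (hu : Integrable u) (h0 : ∫ x, u x = 0)
    {A : Set E} (hA : MeasurableSet A) : 2 * |∫ x in A, u x| ≤ ∫ x, |u x| := by
  have h1 := integral_add_compl hA hu
  have h2 := integral_add_compl hA hu.abs
  have h3 : |∫ x in A, u x| ≤ ∫ x in A, |u x| := abs_integral_le_integral_abs
  have h4 : |∫ x in Aᶜ, u x| ≤ ∫ x in Aᶜ, |u x| := abs_integral_le_integral_abs
  have h5 : ∫ x in Aᶜ, u x = -∫ x in A, u x := by linarith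
  rw [h5, abs_neg] at h4
  linarith

/-- Scheffé's identity: the positive and negative parts have equal mass, so the previous bound is
attained on the positivity set. -/
lemma integral_abs_eq_two_mul_setIntegral {u : E → ℝ} (hu : Integrable u) (hm : Measurable u)
    (h0 : ∫ x, u x = 0) : ∫ x, |u x| = 2 * ∫ x in {x | 0 < u x}, u x := by
  have hA : MeasurableSet {x | 0 < u x} := measurableSet_lt measurable_const hm
  have h1 := integral_add_compl hA hu
  have h2 := integral_add_compl hA hu.abs
  have h3 : ∫ x in {x | 0 < u x}, |u x| = ∫ x in {x | 0 < u x}, u x :=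
    setIntegral_congr_fun hA fun x hx => abs_of_pos hx
  have h4 : ∫ x in {x | 0 < u x}ᶜ, |u x| = ∫ x in {x | 0 < u x}ᶜ, -u x :=
    setIntegral_congr_fun hA.compl fun x hx => abs_of_nonpos (not_lt.mp hx)
  rw [integral_neg] at h4
  linarith

/-- The oracle inequality for minimum distance estimates: `e` holds the empirical measures of the
Yatracos sets `{q j < q i}`, and `a` is a member of the family that fits them best. -/
lemma integral_abs_sub_le_of_minimum_distance {ι : Type*} {q : ι → E → ℝ}
    (hq : ∀ i, IsPdf (q i)) (hqm : ∀ i, Measurable (q i)) {p : E → ℝ} (hp : IsPdf p)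
    {e : ι → ι → ℝ} {D : ι → ℝ}
    (hD : ∀ c i j, |(∫ x in {x | q j x < q i x}, q c x) - e i j| ≤ D c)
    {a : ι} (ha : ∀ c, D a ≤ D c)
    (hD' : ∀ c r, (∀ i j, |(∫ x in {x | q j x < q i x}, q c x) - e i j| ≤ r) → D c ≤ r)
    {t : ℝ} (ht : ∀ i j, |(∫ x in {x | q j x < q i x}, p x) - e i j| ≤ t) (c : ι) :
    ∫ x, |p x - q a x| ≤ 3 * (∫ x, |p x - q c x|) + 4 * t := by
  have hA : ∀ i j, MeasurableSet {x | q j x < q i x} := fun i j =>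
    measurableSet_lt (hqm j) (hqm i)
  have hcp : ∀ i j, |(∫ x in {x | q j x < q i x}, q c x) - e i j|
      ≤ (∫ x, |p x - q c x|) / 2 + t := by
    intro i j
    have h1 := two_mul_abs_setIntegral_le (hp.integrable.sub (hq c).integrable)
      (by simp only [Pi.sub_apply]
          rw [integral_sub hp.integrable (hq c).integrable, hp.integral_eq_one,
            (hq c).integral_eq_one, sub_self]) (hA i j)
    simp only [Pi.sub_apply] at h1
    rw [integral_sub hp.integrable.integrableOn (hq c).integrable.integrableOn] at h1
    have h2 := ht i j
    rw [abs_le] at h2 ⊢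
    have h3 := le_abs_self ((∫ x in {x | q j x < q i x}, p x) - ∫ x in {x | q j x < q i x}, q c x)
    have h4 := neg_abs_le
      ((∫ x in {x | q j x < q i x}, p x) - ∫ x in {x | q j x < q i x}, q c x)
    constructor <;> linarith [h2.1, h2.2]
  have hDc := hD' c _ hcp
  -- The positivity set of `q c - q a` is itself a Yatracos set, on which both densities are
  -- compared with `e c a`; this gives `2 (D c + D a)`, and `a` minimizes `D`.
  have hca : ∫ x, |q c x - q a x| ≤ 4 * D c := by
    have h1 := integral_abs_eq_two_mul_setIntegral ((hq c).integrable.sub (hq a).integrable)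
      ((hqm c).sub (hqm a))
      (by simp only [Pi.sub_apply]
          rw [integral_sub (hq c).integrable (hq a).integrable, (hq c).integral_eq_one,
            (hq a).integral_eq_one, sub_self])
    simp only [Pi.sub_apply, sub_pos] at h1
    rw [integral_sub (hq c).integrable.integrableOn (hq a).integrable.integrableOn] at h1
    have h2 := (abs_le.mp (hD c c a)).2
    have h3 := (abs_le.mp (hD a c a)).1
    linarith [ha c]
  have htri := integral_abs_sub_le_add hp.integrable (hq c).integrable (hq a).integrable
  linarith

end MinimumDistance

/-! ### Concentration and measurable selection -/

section Selection

variable {d : ℕ}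

lemma densityMeasure_real {p : (Fin d → ℝ) → ℝ} (hp : IsPdf p) {A : Set (Fin d → ℝ)}
    (hA : MeasurableSet A) : (densityMeasure p).real A = ∫ x in A, p x := by
  rw [Measure.real, densityMeasure, withDensity_apply _ hA,
    ← ofReal_integral_eq_lintegral_ofReal hp.integrable.integrableOn
      (ae_restrict_of_ae hp.nonneg),
    ENNReal.toReal_ofReal (integral_nonneg_of_ae (ae_restrict_of_ae hp.nonneg))]

/-- Two-sided Hoeffding bound: centred indicators are sub-Gaussian with variance proxy `1 / 4`, and
the one-sided bound is applied to them and to their negatives. -/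
lemma measureReal_abs_sum_sub_ge_le {p : (Fin d → ℝ) → ℝ} (hp : IsPdf p) {n : ℕ} (hn : 0 < n)
    {Ω : Type*} [MeasurableSpace Ω] {P : Measure Ω} [IsProbabilityMeasure P]
    {X : Fin n → Ω → (Fin d → ℝ)} (hX : ∀ l, HasLaw (X l) (densityMeasure p) P)
    (hind : iIndepFun X P) {A : Set (Fin d → ℝ)} (hA : MeasurableSet A) {t : ℝ} (ht : 0 ≤ t) :
    P.real {ω | t < |(∫ x in A, p x) - (∑ l, A.indicator (fun _ => (1 : ℝ)) (X l ω)) / n|}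
      ≤ 2 * Real.exp (-2 * n * t ^ 2) := by
  have hn' : (0 : ℝ) < n := Nat.cast_pos.mpr hn
  have hind_meas : Measurable (A.indicator fun _ => (1 : ℝ)) := measurable_const.indicator hA
  have hmean : ∀ l, ∫ ω, A.indicator (fun _ => (1 : ℝ)) (X l ω) ∂P = ∫ x in A, p x := by
    intro l
    have := (hX l).integral_comp (f := A.indicator fun _ => (1 : ℝ))
      hind_meas.aestronglyMeasurable
    rw [← densityMeasure_real hp hA, ← integral_indicator_one hA]
    exact this
  set c : ℝ := ∫ x in A, p x
  have hsub : ∀ l, HasSubgaussianMGF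
      (fun ω => A.indicator (fun _ => (1 : ℝ)) (X l ω) - c) ((1 / 2) ^ 2) P := by
    intro l
    have h := hasSubgaussianMGF_of_mem_Icc (μ := P)
      (X := fun ω => A.indicator (fun _ => (1 : ℝ)) (X l ω)) (a := 0) (b := 1)
      (hind_meas.comp_aemeasurable (hX l).aemeasurable)
      (Filter.Eventually.of_forall fun ω => by
        by_cases h : X l ω ∈ A <;> simp [h])
    rw [hmean l] at h
    simpa using h
  have hI : iIndepFun (fun l ω => A.indicator (fun _ => (1 : ℝ)) (X l ω) - c) P :=
    hind.comp (fun _ x => A.indicator (fun _ => (1 : ℝ)) x - c)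
      fun _ => hind_meas.sub measurable_const
  have hI' : iIndepFun (fun l ω => -(A.indicator (fun _ => (1 : ℝ)) (X l ω) - c)) P :=
    hind.comp (fun _ x => -(A.indicator (fun _ => (1 : ℝ)) x - c))
      fun _ => (hind_meas.sub measurable_const).neg
  have hsub' : ∀ l, HasSubgaussianMGF
      (fun ω => -(A.indicator (fun _ => (1 : ℝ)) (X l ω) - c)) ((1 / 2) ^ 2) P :=
    fun l => (hsub l).neg
  have h1 := HasSubgaussianMGF.measure_sum_ge_le_of_iIndepFun hI (s := Finset.univ)
    (fun l _ => hsub l) (mul_nonneg hn'.le ht)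
  have h2 := HasSubgaussianMGF.measure_sum_ge_le_of_iIndepFun hI' (s := Finset.univ)
    (fun l _ => hsub' l) (mul_nonneg hn'.le ht)
  have hexp : -(n * t) ^ 2 / (2 * ((∑ _l : Fin n, ((1 / 2) ^ 2 : ℝ≥0) : ℝ≥0) : ℝ))
      = -2 * n * t ^ 2 := by
    simp
    field_simp
  rw [hexp] at h1 h2
  refine (measureReal_mono ?_).trans ((measureReal_union_le
    {ω | (n : ℝ) * t ≤ ∑ l, (A.indicator (fun _ => (1 : ℝ)) (X l ω) - c)}
    {ω | (n : ℝ) * t ≤ ∑ l, -(A.indicator (fun _ => (1 : ℝ)) (X l ω) - c)}).trans (by linarith))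
  intro ω hω
  simp only [Set.mem_ofPred_eq, Set.mem_union, Finset.sum_neg_distrib, Finset.sum_sub_distrib,
    Finset.sum_const, Finset.card_univ, Fintype.card_fin, nsmul_eq_mul] at hω ⊢
  set S := ∑ l, A.indicator (fun _ => (1 : ℝ)) (X l ω)
  have hS : S = n * (S / n) := by field_simp
  rcases lt_abs.mp hω with h | h
  · right
    nlinarith
  · left
    nlinarith

/-- From finitely many candidate densities one can measurably select one which is, with high
probability, almost as close to the sampling density as three times the best distance. -/
theorem exists_measurable_selector {ι : Type*} [Fintype ι] [Nonempty ι] [MeasurableSpace ι]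
    (q : ι → (Fin d → ℝ) → ℝ) (hq : ∀ i, IsPdf (q i)) (hqm : ∀ i, Measurable (q i))
    (n : ℕ) (hn : 0 < n) :
    ∃ g : (Fin n → (Fin d → ℝ)) → ι, Measurable g ∧
      ∀ p : (Fin d → ℝ) → ℝ, IsPdf p →
        ∀ (Ω : Type*) [MeasurableSpace Ω] (P : Measure Ω) [IsProbabilityMeasure P]
          (X : Fin n → Ω → (Fin d → ℝ)),
          (∀ i, HasLaw (X i) (densityMeasure p) P) → iIndepFun X P → ∀ t : ℝ, 0 ≤ t →
          P.real {ω | ∃ c, 3 * (∫ x, |p x - q c x|) + 4 * t <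
              ∫ x, |p x - q (g fun l => X l ω) x|}
            ≤ Fintype.card ι ^ 2 * (2 * Real.exp (-2 * n * t ^ 2)) := by
  classical
  have hA : ∀ i j, MeasurableSet {x | q j x < q i x} := fun i j =>
    measurableSet_lt (hqm j) (hqm i)
  -- The empirical measures depend on the sample only through the pattern `π` of memberships in
  -- Yatracos sets. There are finitely many patterns, so any choice of minimizer per pattern is
  -- measurable.
  let e : (Fin n → ι → ι → Prop) → ι → ι → ℝ := fun π i j =>
    (∑ l, if π l i j then (1 : ℝ) else 0) / n
  let D : (Fin n → ι → ι → Prop) → ι → ℝ := fun π c =>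
    Finset.univ.sup' Finset.univ_nonempty
      fun r : ι × ι => |(∫ x in {x | q r.2 x < q r.1 x}, q c x) - e π r.1 r.2|
  have hex : ∀ π, ∃ a, ∀ c, D π a ≤ D π c := fun π => Finite.exists_min (D π)
  choose g hg using hex
  let π : (Fin n → (Fin d → ℝ)) → Fin n → ι → ι → Prop := fun s l i j => q j (s l) < q i (s l)
  have hπ : Measurable π := by
    refine measurable_pi_lambda _ fun l => measurable_pi_lambda _ fun i =>
      measurable_pi_lambda _ fun j => ?_
    exact measurableSet_setOfPred.mp ((hA i j).preimage (measurable_pi_apply l))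
  refine ⟨g ∘ π, (Measurable.of_discrete (f := g)).comp hπ, ?_⟩
  intro p hp Ω _ P _ X hX hind t ht
  have hbound := fun r : ι × ι => measureReal_abs_sum_sub_ge_le hp hn hX hind (hA r.1 r.2) ht
  refine (measureReal_mono ?_).trans ((measureReal_iUnion_fintype_le _).trans
    ((Finset.sum_le_sum fun r _ => hbound r).trans (by simp [sq])))
  rintro ω ⟨c, hc⟩
  by_contra hω
  simp only [Set.mem_iUnion, Set.mem_ofPred_eq, not_exists, not_lt] at hω
  refine hc.not_ge (integral_abs_sub_le_of_minimum_distance hq hqm hp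
    (e := e (π fun l => X l ω)) (D := D (π fun l => X l ω))
    (fun c i j => Finset.le_sup' (fun r : ι × ι =>
      |(∫ x in {x | q r.2 x < q r.1 x}, q c x) - e (π fun l => X l ω) r.1 r.2|)
      (Finset.mem_univ (i, j)))
    (hg _) (fun c r h => Finset.sup'_le _ _ fun s _ => h s.1 s.2) (fun i j => ?_) c)
  have := hω (i, j)
  simpa [e, π, Set.indicator_apply] using this

end Selection

/-! ### `L¹` stability of products and mixtures -/

section Mixtures

lemma IsPdf.fintype_prod {d : ℕ} {f : Fin d → ℝ → ℝ} (hf : ∀ j, IsPdf (f j)) :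
    IsPdf fun x : Fin d → ℝ => ∏ j, f j (x j) where
  integrable := Integrable.fintype_prod fun j => (hf j).integrable
  nonneg := by
    have h : ∀ j, ∀ᵐ x : Fin d → ℝ, 0 ≤ f j (x j) := fun j =>
      (Measure.quasiMeasurePreserving_eval (fun _ : Fin d => (volume : Measure ℝ)) j).ae
        (hf j).nonneg
    filter_upwards [ae_all_iff.mpr h] with x hx
    exact Finset.prod_nonneg fun j _ => hx j
  integral_eq_one := by
    rw [integral_fintype_prod_volume_eq_prod]
    simp [fun j => (hf j).integral_eq_one]

lemma IsPdf.integral_abs {E : Type*} [MeasureSpace E] {f : E → ℝ} (hf : IsPdf f) :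
    ∫ x, |f x| = 1 := by
  rw [← hf.integral_eq_one]
  exact integral_congr_ae (hf.nonneg.mono fun x hx => abs_of_nonneg hx)

/-- The `L¹` distance of two product densities is at most the sum of the `L¹` distances of the
marginals. -/
lemma integral_abs_prod_sub_prod_le {d : ℕ} {f g : Fin d → ℝ → ℝ} (hf : ∀ j, IsPdf (f j))
    (hg : ∀ j, IsPdf (g j)) :
    ∫ x : Fin d → ℝ, |∏ j, f j (x j) - ∏ j, g j (x j)| ≤ ∑ j, ∫ t, |f j t - g j t| := by
  classical
  -- Telescoping: the factors `g j` are exchanged for `f j` one coordinate at a time.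
  have key : ∀ s : Finset (Fin d),
      ∫ x : Fin d → ℝ, |∏ j, (if j ∈ s then f j else g j) (x j) - ∏ j, g j (x j)|
        ≤ ∑ j ∈ s, ∫ t, |f j t - g j t| := by
    intro s
    induction s using Finset.induction_on with
    | empty => simp
    | insert a s ha ih =>
      have hpdf : ∀ s : Finset (Fin d),
          IsPdf fun x : Fin d → ℝ => ∏ j, (if j ∈ s then f j else g j) (x j) := fun s =>
        IsPdf.fintype_prod fun j => by split_ifs; exacts [hf j, hg j]
      have htri := integral_abs_sub_le_add (hpdf (insert a s)).integrable (hpdf s).integrable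
        (IsPdf.fintype_prod hg).integrable
      rw [Finset.sum_insert ha]
      refine htri.trans (add_le_add (le_of_eq ?_) ih)
      -- Two products differing only in coordinate `a` have a difference that is again a product, so
      -- Fubini applies and all other factors integrate to one.
      let u : Fin d → ℝ → ℝ := fun j t =>
        |if j = a then f a t - g a t else (if j ∈ s then f j else g j) t|
      have hu : ∀ x : Fin d → ℝ, |∏ j, (if j ∈ insert a s then f j else g j) (x j)
          - ∏ j, (if j ∈ s then f j else g j) (x j)| = ∏ j, u j (x j) := by
        intro x
        rw [← Finset.abs_prod, ← Finset.mul_prod_erase _ _ (Finset.mem_univ a),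
          ← Finset.mul_prod_erase Finset.univ
            (fun j => (if j ∈ s then f j else g j) (x j)) (Finset.mem_univ a),
          ← Finset.mul_prod_erase Finset.univ (fun j => if j = a then f a (x j) - g a (x j)
            else (if j ∈ s then f j else g j) (x j)) (Finset.mem_univ a)]
        have h1 : ∏ j ∈ Finset.univ.erase a, (if j ∈ insert a s then f j else g j) (x j)
            = ∏ j ∈ Finset.univ.erase a, (if j ∈ s then f j else g j) (x j) :=
          Finset.prod_congr rfl fun j hj => by simp [Finset.ne_of_mem_erase hj]
        have h2 : ∏ j ∈ Finset.univ.erase a, (if j = a then f a (x j) - g a (x j)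
            else (if j ∈ s then f j else g j) (x j))
            = ∏ j ∈ Finset.univ.erase a, (if j ∈ s then f j else g j) (x j) :=
          Finset.prod_congr rfl fun j hj => by simp [Finset.ne_of_mem_erase hj]
        rw [h1, h2, ← sub_mul]
        simp [ha]
      simp_rw [hu]
      rw [integral_fintype_prod_volume_eq_prod, ← Finset.mul_prod_erase _ _ (Finset.mem_univ a),
        Finset.prod_eq_one, mul_one]
      · simp [u]
      · intro j hj
        simp only [u, if_neg (Finset.ne_of_mem_erase hj)]
        exact IsPdf.integral_abs (by split_ifs; exacts [hf j, hg j])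
  simpa using key Finset.univ

lemma IsPdf.convexCombination {E ι : Type*} [MeasureSpace E] [Fintype ι] {v : ι → ℝ}
    (hv : v ∈ stdSimplex ℝ ι) {f : ι → E → ℝ} (hf : ∀ i, IsPdf (f i)) :
    IsPdf fun x => ∑ i, v i * f i x where
  integrable := integrable_finsetSum _ fun i _ => (hf i).integrable.const_mul _
  nonneg := by
    filter_upwards [ae_all_iff.mpr fun i => (hf i).nonneg] with x hx
    exact Finset.sum_nonneg fun i _ => mul_nonneg (hv.1 i) (hx i)
  integral_eq_one := by
    rw [integral_finsetSum _ fun i _ => (hf i).integrable.const_mul _]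
    simp [integral_const_mul, fun i => (hf i).integral_eq_one, hv.2]

lemma integral_abs_sum_sub_sum_le {E ι : Type*} [MeasureSpace E] [Fintype ι] {w v : ι → ℝ}
    (hw : ∀ i, 0 ≤ w i) {f g : ι → E → ℝ} (hf : ∀ i, IsPdf (f i)) (hg : ∀ i, IsPdf (g i)) :
    ∫ x, |∑ i, w i * f i x - ∑ i, v i * g i x|
      ≤ ∑ i, w i * (∫ x, |f i x - g i x|) + ∑ i, |w i - v i| := by
  have hfg : ∀ i, Integrable fun x => w i * |f i x - g i x| := fun i =>
    ((hf i).integrable.sub (hg i).integrable).abs.const_mul _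
  have hgi : ∀ i, Integrable fun x => |w i - v i| * |g i x| := fun i =>
    (hg i).integrable.abs.const_mul _
  have hsum : ∀ i, Integrable fun x => w i * |f i x - g i x| + |w i - v i| * |g i x| := fun i =>
    (hfg i).add (hgi i)
  have hwf : Integrable fun x => ∑ i, w i * f i x :=
    integrable_finsetSum _ fun i _ => (hf i).integrable.const_mul _
  have hvg : Integrable fun x => ∑ i, v i * g i x :=
    integrable_finsetSum _ fun i _ => (hg i).integrable.const_mul _
  have h1 : ∑ i, w i * (∫ x, |f i x - g i x|) + ∑ i, |w i - v i|
      = ∫ x, ∑ i, (w i * |f i x - g i x| + |w i - v i| * |g i x|) := by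
    rw [integral_finsetSum _ fun i _ => hsum i, ← Finset.sum_add_distrib]
    refine Finset.sum_congr rfl fun i _ => ?_
    rw [integral_add (hfg i) (hgi i), integral_const_mul, integral_const_mul,
      (hg i).integral_abs, mul_one]
  rw [h1]
  refine integral_mono (hwf.sub hvg).abs
    (integrable_finsetSum _ fun i _ => hsum i) fun x => ?_
  simp only
  rw [← Finset.sum_sub_distrib]
  refine (Finset.abs_sum_le_sum_abs _ _).trans (Finset.sum_le_sum fun i _ => ?_)
  rw [show w i * f i x - v i * g i x = w i * (f i x - g i x) + (w i - v i) * g i x by ring]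
  refine (abs_add_le _ _).trans (le_of_eq ?_)
  rw [abs_mul, abs_mul, abs_of_nonneg (hw i)]

end Mixtures

/-! ### Rounding probability vectors to a grid -/

section Rounding

/-- Probability vectors of length `b` whose entries are multiples of `1 / m`, scaled by `m`. -/
def SimplexGrid (b m : ℕ) : Type := {a : Fin b → Fin (m + 1) // ∑ i, (a i : ℕ) = m}

namespace SimplexGrid

variable {b m : ℕ}

instance : Fintype (SimplexGrid b m) :=
  inferInstanceAs (Fintype {a : Fin b → Fin (m + 1) // ∑ i, (a i : ℕ) = m})

/-- The probability vector of a grid point. -/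
def toVec (g : SimplexGrid b m) : Fin b → ℝ := fun i => (g.1 i : ℕ) / m

lemma toVec_mem (hm : 0 < m) (g : SimplexGrid b m) : g.toVec ∈ stdSimplex ℝ (Fin b) := by
  have hm' : (m : ℝ) ≠ 0 := by positivity
  refine ⟨fun i => by unfold toVec; positivity, ?_⟩
  simp only [toVec]
  rw [← Finset.sum_div, div_eq_one_iff_eq hm']
  exact_mod_cast g.2

lemma card_le : Fintype.card (SimplexGrid b m) ≤ (m + 1) ^ b := by
  have h : Fintype.card (SimplexGrid b m) ≤ Fintype.card (Fin b → Fin (m + 1)) :=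
    Fintype.card_le_of_injective (fun g : SimplexGrid b m => g.1) Subtype.val_injective
  simpa using h

/-- Every probability vector is close to a grid point. -/
lemma exists_sum_abs_sub_le (hb : 0 < b) (hm : 0 < m) {α : Fin b → ℝ}
    (hα : α ∈ stdSimplex ℝ (Fin b)) :
    ∃ g : SimplexGrid b m, ∑ i, |α i - g.toVec i| ≤ 2 * b / m := by
  have hm' : (0 : ℝ) < m := Nat.cast_pos.mpr hm
  let z : Fin b := ⟨0, hb⟩
  let r : Fin b → ℕ := fun i => ⌊m * α i⌋₊
  have hr : ∀ i, (r i : ℝ) ≤ m * α i := fun i =>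
    Nat.floor_le (mul_nonneg hm'.le (hα.1 i))
  have hr' : ∀ i, m * α i ≤ r i + 1 := fun i => (Nat.lt_floor_add_one _).le
  have hsum : ∑ i, (m : ℝ) * α i = m := by rw [← Finset.mul_sum, hα.2, mul_one]
  have hle : ∑ i, r i ≤ m := by
    have h : (∑ i, (r i : ℝ)) ≤ m := hsum ▸ Finset.sum_le_sum fun i _ => hr i
    exact_mod_cast h
  -- Rounding down loses at most one unit per entry, and the total deficit, at most `b`, is returned
  -- to entry `z`: together at most `2 b` units of size `1 / m`.
  let c : Fin b → ℕ := fun i => r i + if i = z then m - ∑ i, r i else 0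
  have hc : ∑ i, c i = m := by
    simp only [c, Finset.sum_add_distrib, Finset.sum_ite_eq', Finset.mem_univ, if_true]
    omega
  have hcm : ∀ i, c i < m + 1 := fun i =>
    Nat.lt_succ_of_le (hc ▸ Finset.single_le_sum (fun _ _ => Nat.zero_le _) (Finset.mem_univ i))
  refine ⟨⟨fun i => ⟨c i, hcm i⟩, hc⟩, ?_⟩
  have hdef : ((m - ∑ i, r i : ℕ) : ℝ) ≤ b := by
    rw [Nat.cast_sub hle, Nat.cast_sum, sub_le_iff_le_add']
    calc (m : ℝ) = ∑ i, (m : ℝ) * α i := hsum.symm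
      _ ≤ ∑ i, ((r i : ℝ) + 1) := Finset.sum_le_sum fun i _ => hr' i
      _ = _ := by simp [Finset.sum_add_distrib]
  have hterm : ∀ i, |α i - (c i : ℕ) / m|
      ≤ (1 + if i = z then ((m - ∑ i, r i : ℕ) : ℝ) else 0) / m := by
    intro i
    have h0 : (0 : ℝ) ≤ if i = z then ((m - ∑ i, r i : ℕ) : ℝ) else 0 := by positivity
    have hci : (c i : ℝ) = r i + if i = z then ((m - ∑ i, r i : ℕ) : ℝ) else 0 := by
      simp only [c]
      split_ifs <;> simp
    rw [hci]
    generalize (if i = z then ((m - ∑ i, r i : ℕ) : ℝ) else 0) = y at h0 ⊢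
    rw [show α i - (r i + y) / m = (m * α i - r i - y) / m by field_simp; ring, abs_div,
      abs_of_pos hm']
    gcongr
    rw [abs_le]
    constructor <;> linarith [hr i, hr' i]
  calc ∑ i, |α i - (c i : ℕ) / m|
      ≤ ∑ i, (1 + if i = z then ((m - ∑ i, r i : ℕ) : ℝ) else 0) / m :=
        Finset.sum_le_sum fun i _ => hterm i
    _ = (b + ((m - ∑ i, r i : ℕ) : ℝ)) / m := by
        rw [← Finset.sum_div, Finset.sum_add_distrib]
        simp
    _ ≤ 2 * b / m := by gcongr; linarith

end SimplexGrid

end Rounding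

/-! ### Histogram approximation of Lipschitz densities -/

section Histograms

/-- The half-open bin `[i / b, (i + 1) / b)`. -/
def bin (b : ℕ) (i : ℕ) : Set ℝ := Set.Ico ((i : ℝ) / b) (((i : ℝ) + 1) / b)

/-- The histogram with `b` bins whose bin probabilities are `α`. -/
def hist {b : ℕ} (α : Fin b → ℝ) (t : ℝ) : ℝ :=
  ∑ i : Fin b, (b * α i) * (bin b i).indicator (fun _ => (1 : ℝ)) t

variable {b : ℕ}

lemma measurableSet_bin (i : ℕ) : MeasurableSet (bin b i) := measurableSet_Ico

lemma bin_injective {i j : ℕ} (hb : 0 < b) {t : ℝ} (hi : t ∈ bin b i) (hj : t ∈ bin b j) :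
    i = j := by
  have hb' : (0 : ℝ) < b := Nat.cast_pos.mpr hb
  obtain ⟨h1, h2⟩ := hi
  obtain ⟨h3, h4⟩ := hj
  rw [div_le_iff₀ hb'] at h1 h3
  rw [lt_div_iff₀ hb'] at h2 h4
  have h5 : (i : ℝ) < j + 1 := by linarith
  have h6 : (j : ℝ) < i + 1 := by linarith
  norm_cast at h5 h6
  omega

lemma bin_subset (hb : 0 < b) {i : ℕ} (hi : i < b) : bin b i ⊆ Set.Ico 0 1 := by
  have hb' : (0 : ℝ) < b := Nat.cast_pos.mpr hb
  refine Set.Ico_subset_Ico (by positivity) ?_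
  rw [div_le_one hb']
  exact_mod_cast hi

lemma exists_mem_bin (hb : 0 < b) {t : ℝ} (ht : t ∈ Set.Ico (0 : ℝ) 1) :
    ∃ i : Fin b, t ∈ bin b i := by
  have hb' : (0 : ℝ) < b := Nat.cast_pos.mpr hb
  have h0 : 0 ≤ t * b := mul_nonneg ht.1 hb'.le
  refine ⟨⟨⌊t * b⌋₊, (Nat.floor_lt h0).mpr (by nlinarith [ht.2])⟩, ?_, ?_⟩
  · rw [div_le_iff₀ hb']
    exact Nat.floor_le h0
  · rw [lt_div_iff₀ hb']
    exact Nat.lt_floor_add_one _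

lemma volume_real_bin (i : ℕ) : volume.real (bin b i) = 1 / b := by
  rw [bin, Measure.real, Real.volume_Ico, ← sub_div, add_sub_cancel_left,
    ENNReal.toReal_ofReal (by positivity)]

lemma integrable_indicator_bin (i : ℕ) :
    Integrable ((bin b i).indicator fun _ => (1 : ℝ)) :=
  (integrable_indicator_iff (measurableSet_bin i)).mpr
    (integrableOn_const (by simp [bin]))

lemma measurable_hist (α : Fin b → ℝ) : Measurable (hist α) :=
  Finset.measurable_sum _ fun i _ =>
    (measurable_const.indicator (measurableSet_bin i)).const_mul _

lemma integrable_hist (α : Fin b → ℝ) : Integrable (hist α) :=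
  integrable_finsetSum _ fun _ _ => (integrable_indicator_bin _).const_mul _

lemma integral_hist (hb : 0 < b) (α : Fin b → ℝ) : ∫ t, hist α t = ∑ i, α i := by
  have hb' : (b : ℝ) ≠ 0 := by positivity
  unfold hist
  rw [integral_finsetSum _ fun i _ => (integrable_indicator_bin _).const_mul _]
  refine Finset.sum_congr rfl fun i _ => ?_
  rw [integral_const_mul, integral_indicator_const _ (measurableSet_bin i), volume_real_bin]
  simp only [smul_eq_mul]
  field_simp

lemma hist_nonneg {α : Fin b → ℝ} (hα : ∀ i, 0 ≤ α i) (t : ℝ) : 0 ≤ hist α t :=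
  Finset.sum_nonneg fun i _ => mul_nonneg (mul_nonneg (Nat.cast_nonneg _) (hα i))
    (Set.indicator_nonneg (fun _ _ => zero_le_one) _)

lemma isPdf_hist (hb : 0 < b) {α : Fin b → ℝ} (hα : α ∈ stdSimplex ℝ (Fin b)) :
    IsPdf (hist α) :=
  ⟨integrable_hist α, Filter.Eventually.of_forall (hist_nonneg hα.1),
    (integral_hist hb α).trans hα.2⟩

lemma hist_mem_histograms (hb : 0 < b) {α : Fin b → ℝ} (hα : α ∈ stdSimplex ℝ (Fin b)) :
    hist α ∈ histograms b :=
  ⟨fun i => b * α i, fun i => mul_nonneg (Nat.cast_nonneg _) (hα.1 i), rfl,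
    (isPdf_hist hb hα).integral_eq_one⟩

lemma hist_eq_zero (hb : 0 < b) (α : Fin b → ℝ) {t : ℝ} (ht : t ∉ Set.Ico (0 : ℝ) 1) :
    hist α t = 0 :=
  Finset.sum_eq_zero fun i _ => by
    rw [Set.indicator_of_notMem fun h => ht (bin_subset hb i.2 h), mul_zero]

lemma hist_eq_of_mem_bin (hb : 0 < b) (α : Fin b → ℝ) {t : ℝ} {i : Fin b} (ht : t ∈ bin b i) :
    hist α t = b * α i := by
  unfold hist
  rw [Finset.sum_eq_single i]
  · rw [Set.indicator_of_mem ht, mul_one]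
  · intro j _ hj
    rw [Set.indicator_of_notMem fun h => hj (Fin.ext (bin_injective hb h ht)), mul_zero]
  · simp

lemma integral_abs_hist_sub_hist_le (hb : 0 < b) (α β : Fin b → ℝ) :
    ∫ t, |hist α t - hist β t| ≤ ∑ i, |α i - β i| := by
  rw [← integral_hist hb fun i => |α i - β i|]
  refine integral_mono ((integrable_hist α).sub (integrable_hist β)).abs (integrable_hist _)
    fun t => ?_
  by_cases ht : t ∈ Set.Ico (0 : ℝ) 1
  · obtain ⟨i, hi⟩ := exists_mem_bin hb ht
    simp only [hist_eq_of_mem_bin hb _ hi]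
    rw [← mul_sub, abs_mul, Nat.abs_cast]
  · simp [hist_eq_zero hb _ ht]

/-- A Lipschitz function differs from its mean over an interval of length `h` by at most
`K h ^ 2 / √12` in `L¹`. -/
lemma integral_abs_sub_average_le {q : ℝ → ℝ} {K : ℝ} (hK : 0 < K)
    (hq : ∀ x y, |q x - q y| ≤ K * |x - y|) (hc : Continuous q) (s : ℝ) {h : ℝ} (hh : 0 < h) :
    ∫ x in s..s + h, |q x - (∫ y in s..s + h, q y) / h| ≤ K * h ^ 2 / Real.sqrt 12 := by
  set a : ℝ := (∫ y in s..s + h, q y) / h with ha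
  have hah : ∫ y in s..s + h, q y = a * h := by rw [ha]; field_simp
  have hle : s ≤ s + h := by linarith
  -- The mean minimizes the squared deviation, so comparison with the midpoint value bounds the
  -- variance integral.
  let c := q (s + h / 2)
  have hvar : ∫ x in s..s + h, (q x - a) ^ 2 ≤ K ^ 2 * h ^ 3 / 12 := by
    have h1 : ∫ x in s..s + h, (q x - c) ^ 2 = (∫ x in s..s + h, (q x - a) ^ 2)
        + h * (a - c) ^ 2 := by
      have e : ∀ x, (q x - c) ^ 2 = (q x - a) ^ 2 + (2 * (a - c) * q x - (a ^ 2 - c ^ 2)) :=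
        fun x => by ring
      simp_rw [e]
      rw [intervalIntegral.integral_add (Continuous.intervalIntegrable (by fun_prop) _ _)
        (Continuous.intervalIntegrable (by fun_prop) _ _),
        intervalIntegral.integral_sub (Continuous.intervalIntegrable (by fun_prop) _ _)
        (Continuous.intervalIntegrable (by fun_prop) _ _),
        intervalIntegral.integral_const_mul, hah, intervalIntegral.integral_const]
      simp only [smul_eq_mul]
      ring
    have h2 : ∫ x in s..s + h, (q x - c) ^ 2
        ≤ ∫ x in s..s + h, K ^ 2 * (x - (s + h / 2)) ^ 2 := by
      refine intervalIntegral.integral_mono_on hle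
        (Continuous.intervalIntegrable (by fun_prop) _ _)
        (Continuous.intervalIntegrable (by fun_prop) _ _) fun x _ => ?_
      rw [← mul_pow, ← sq_abs, ← sq_abs (K * _), abs_mul, abs_of_pos hK]
      gcongr
      exact hq _ _
    have h3 : ∫ x in s..s + h, K ^ 2 * (x - (s + h / 2)) ^ 2 = K ^ 2 * h ^ 3 / 12 := by
      rw [intervalIntegral.integral_const_mul,
        intervalIntegral.integral_comp_sub_right (fun x => x ^ 2), integral_pow]
      norm_num
      ring
    have h4 : 0 ≤ h * (a - c) ^ 2 := by positivity
    linarith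
  have h12 : (0 : ℝ) < Real.sqrt 12 := by positivity
  have hs : Real.sqrt 12 ^ 2 = 12 := Real.sq_sqrt (by norm_num)
  set r := Real.sqrt 12
  -- Cauchy–Schwarz in the form `|u| ≤ k u² / 2 + 1 / (2k)`; this `k` balances the two terms after
  -- integration.
  let k : ℝ := r / (K * h)
  have hk : 0 < k := by positivity
  have hpt : ∀ x, |q x - a| ≤ k / 2 * (q x - a) ^ 2 + 1 / (2 * k) := by
    intro x
    rw [← sq_abs (q x - a), ← sub_nonneg]
    have : k / 2 * |q x - a| ^ 2 + 1 / (2 * k) - |q x - a|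
        = (k * |q x - a| - 1) ^ 2 / (2 * k) := by
      field_simp
      ring
    rw [this]
    positivity
  calc ∫ x in s..s + h, |q x - a|
      ≤ ∫ x in s..s + h, (k / 2 * (q x - a) ^ 2 + 1 / (2 * k)) :=
        intervalIntegral.integral_mono_on hle
          (Continuous.intervalIntegrable (by fun_prop) _ _)
          (Continuous.intervalIntegrable (by fun_prop) _ _) fun x _ => hpt x
    _ = k / 2 * (∫ x in s..s + h, (q x - a) ^ 2) + h * (1 / (2 * k)) := by
        rw [intervalIntegral.integral_add (Continuous.intervalIntegrable (by fun_prop) _ _)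
          (Continuous.intervalIntegrable (by fun_prop) _ _),
          intervalIntegral.integral_const_mul, intervalIntegral.integral_const]
        simp
    _ ≤ k / 2 * (K ^ 2 * h ^ 3 / 12) + h * (1 / (2 * k)) := by gcongr
    _ = K * h ^ 2 / r := by
        rw [← hs]
        simp only [k]
        field_simp
        ring

/-- A constant cannot be a density on the whole line. This supplies the `0 < K` required by
`integral_abs_sub_average_le`. -/
lemma LipschitzWith.pos_of_isPdf {q : ℝ → ℝ} {L : ℝ≥0} (hL : LipschitzWith L q)
    (hq : IsPdf q) : 0 < L := by
  by_contra h
  have h0 : L = 0 := by simpa using h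
  subst h0
  have hconst : q = fun _ => q 0 := by
    funext x
    have := hL.dist_le_mul x 0
    simpa [dist_le_zero] using this
  have hi := hq.integrable
  have h1 := hq.integral_eq_one
  rw [hconst] at hi h1
  rcases integrable_const_iff.mp hi with h | h
  · simp [h] at h1
  · exact (measure_lt_top (volume : Measure ℝ) Set.univ).ne Real.volume_univ

/-- A Lipschitz density on `[0, 1]` is within `L / (√12 b)` of a histogram with `b` bins. -/
lemma exists_hist_integral_abs_sub_le (hb : 0 < b) {q : ℝ → ℝ} {L : ℝ≥0} (hq : IsPdf q)
    (hL : LipschitzWith L q) (h01 : ∫ t in Set.Ico (0 : ℝ) 1, q t = 1) :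
    ∃ α ∈ stdSimplex ℝ (Fin b), ∫ t, |q t - hist α t| ≤ L / (Real.sqrt 12 * b) := by
  have hb' : (0 : ℝ) < b := Nat.cast_pos.mpr hb
  have hzero : ∀ᵐ t, t ∉ Set.Ico (0 : ℝ) 1 → q t = 0 := by
    have h1 := integral_add_compl (measurableSet_Ico (a := (0 : ℝ)) (b := 1)) hq.integrable
    rw [h01, hq.integral_eq_one, add_eq_left] at h1
    have h2 := (setIntegral_eq_zero_iff_of_nonneg_ae (ae_restrict_of_ae hq.nonneg)
      hq.integrable.integrableOn).mp h1
    exact (ae_restrict_iff' measurableSet_Ico.compl).mp h2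
  have hbin : ∀ (f : ℝ → ℝ) (i : ℕ), ∫ t in bin b i, f t
      = ∫ t in (i : ℝ) / b..(i : ℝ) / b + 1 / b, f t := by
    intro f i
    rw [intervalIntegral.integral_of_le (by simp), bin, integral_Ico_eq_integral_Ioc, add_div]
  -- With the bin masses as `α`, the histogram value `b * α i` is the mean of `q` over the bin.
  let α : Fin b → ℝ := fun i => ∫ t in bin b i, q t
  have hsum : ∑ i, α i = 1 := by
    have h1 := intervalIntegral.sum_integral_adjacent_intervals (μ := volume) (f := q)
      (a := fun i : ℕ => (i : ℝ) / b) (n := b)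
      fun i _ => hL.continuous.intervalIntegrable _ _
    rw [← h01, integral_Ico_eq_integral_Ioc, ← intervalIntegral.integral_of_le zero_le_one]
    simp only [α, hbin]
    rw [Fin.sum_univ_eq_sum_range
      (fun i : ℕ => ∫ t in (i : ℝ) / b..(i : ℝ) / b + 1 / b, q t) b]
    simpa [add_div, hb'.ne'] using h1
  refine ⟨α, ⟨fun i => setIntegral_nonneg_of_ae hq.nonneg, hsum⟩, ?_⟩
  have hind : ∀ i : Fin b, Integrable ((bin b i).indicator fun t => |q t - b * α i|) := fun i =>
    (integrable_indicator_iff (measurableSet_bin i)).mpr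
      ((Continuous.integrableOn_Icc (a := (i : ℝ) / b) (b := ((i : ℝ) + 1) / b)
        (by have := hL.continuous; fun_prop)).mono_set Set.Ico_subset_Icc_self)
  calc ∫ t, |q t - hist α t|
      = ∫ t, ∑ i : Fin b, (bin b i).indicator (fun t => |q t - b * α i|) t := by
        refine integral_congr_ae ?_
        filter_upwards [hzero] with t ht
        by_cases h : t ∈ Set.Ico (0 : ℝ) 1
        · obtain ⟨i, hi⟩ := exists_mem_bin hb h
          rw [hist_eq_of_mem_bin hb _ hi, Finset.sum_eq_single i]
          · rw [Set.indicator_of_mem hi]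
          · intro j _ hj
            rw [Set.indicator_of_notMem fun h => hj (Fin.ext (bin_injective hb h hi))]
          · simp
        · rw [ht h, hist_eq_zero hb _ h, sub_self, abs_zero, Finset.sum_eq_zero]
          intro i _
          rw [Set.indicator_of_notMem fun h' => h (bin_subset hb i.2 h')]
    _ = ∑ i : Fin b, ∫ t in bin b i, |q t - b * α i| := by
        rw [integral_finsetSum _ fun i _ => hind i]
        exact Finset.sum_congr rfl fun i _ => integral_indicator (measurableSet_bin i)
    _ ≤ ∑ i : Fin b, L * (1 / b) ^ 2 / Real.sqrt 12 := by
        refine Finset.sum_le_sum fun i _ => ?_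
        have h := integral_abs_sub_average_le (K := L) (hL.pos_of_isPdf hq)
          (fun x y => by simpa [Real.dist_eq] using hL.dist_le_mul x y) hL.continuous
          ((i : ℝ) / b) (h := 1 / b) (by positivity)
        rw [← hbin, ← hbin] at h
        simpa [α, mul_comm] using h
    _ = L / (Real.sqrt 12 * b) := by
        simp only [Finset.sum_const, Finset.card_univ, Fintype.card_fin, nsmul_eq_mul]
        field_simp

lemma exists_grid_hist_integral_abs_sub_le (hb : 0 < b) {m : ℕ} (hm : 0 < m) {q : ℝ → ℝ}
    {L : ℝ≥0} (hq : IsPdf q) (hL : LipschitzWith L q)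
    (h01 : ∫ t in Set.Ico (0 : ℝ) 1, q t = 1) :
    ∃ g : SimplexGrid b m,
      ∫ t, |q t - hist g.toVec t| ≤ L / (Real.sqrt 12 * b) + 2 * b / m := by
  obtain ⟨α, hα, h1⟩ := exists_hist_integral_abs_sub_le hb hq hL h01
  obtain ⟨g, hg⟩ := SimplexGrid.exists_sum_abs_sub_le hb hm hα
  exact ⟨g, (integral_abs_sub_le_add hq.integrable (integrable_hist α)
    (integrable_hist g.toVec)).trans
      (add_le_add h1 ((integral_abs_hist_sub_hist_le hb α g.toVec).trans hg))⟩

end Histograms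

/-! ### The finite family of low-rank histograms -/

section Approximation

variable {d b k m : ℕ}

instance [NeZero b] : Nonempty (SimplexGrid b m) :=
  ⟨⟨fun i => if i = 0 then Fin.last m else 0, by simp [apply_ite Fin.val]⟩⟩

/-- Parameters on the grid of mesh `1 / m` for low-rank histograms. -/
def GridParameters (d b k m : ℕ) : Type :=
  SimplexGrid k m × (Fin k → Fin d → SimplexGrid b m)

instance : Fintype (GridParameters d b k m) :=
  inferInstanceAs (Fintype (SimplexGrid k m × (Fin k → Fin d → SimplexGrid b m)))

instance [NeZero b] [NeZero k] : Nonempty (GridParameters d b k m) :=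
  inferInstanceAs (Nonempty (SimplexGrid k m × (Fin k → Fin d → SimplexGrid b m)))

instance : MeasurableSpace (GridParameters d b k m) := ⊤

instance : DiscreteMeasurableSpace (GridParameters d b k m) := ⟨fun _ => trivial⟩

/-- The low-rank histogram whose parameters are grid points. -/
def gridMixture (θ : GridParameters d b k m) (x : Fin d → ℝ) : ℝ :=
  ∑ i, θ.1.toVec i * ∏ j, hist (θ.2 i j).toVec (x j)

lemma measurable_gridMixture (θ : GridParameters d b k m) :
    Measurable (gridMixture θ) :=
  Finset.measurable_sum _ fun _ _ => (Finset.measurable_prod _ fun j _ =>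
    (measurable_hist _).comp (measurable_pi_apply j)).const_mul _

/-- The parameter space is countable, so measurability in `x` for each parameter gives joint
measurability. -/
lemma Measurable.gridMixture {S : Type*} [MeasurableSpace S] {g : S → GridParameters d b k m}
    (hg : Measurable g) : Measurable fun z : S × (Fin d → ℝ) => gridMixture (g z.1) z.2 := by
  have h1 : Measurable (Function.uncurry (_root_.gridMixture (d := d) (b := b) (k := k) (m := m))) :=
    measurable_from_prod_countable_right measurable_gridMixture
  have h2 : Measurable fun z : S × (Fin d → ℝ) => (g z.1, z.2) :=
    (hg.comp measurable_fst).prodMk measurable_snd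
  simpa only [Function.comp_def, Function.uncurry_apply_pair] using h1.comp h2

lemma isPdf_gridMixture (hb : 0 < b) (hm : 0 < m)
    (θ : GridParameters d b k m) : IsPdf (gridMixture θ) :=
  IsPdf.convexCombination (θ.1.toVec_mem hm) fun i =>
    IsPdf.fintype_prod fun j => isPdf_hist hb ((θ.2 i j).toVec_mem hm)

lemma gridMixture_mem_lowRankHistograms (hb : 0 < b) (hm : 0 < m)
    (θ : GridParameters d b k m) :
    gridMixture θ ∈ lowRankHistograms d b k :=
  ⟨θ.1.toVec, fun i j => hist (θ.2 i j).toVec, (θ.1.toVec_mem hm).1, (θ.1.toVec_mem hm).2,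
    fun i j => hist_mem_histograms hb ((θ.2 i j).toVec_mem hm), rfl⟩

lemma gridMixture_mem_unitCubePdfs (hb : 0 < b) (hm : 0 < m)
    (θ : GridParameters d b k m) :
    gridMixture θ ∈ unitCubePdfs d := by
  refine ⟨isPdf_gridMixture hb hm θ, Filter.Eventually.of_forall fun x hx => ?_⟩
  have hj : ∃ j, x j ∉ Set.Ico (0 : ℝ) 1 := by
    by_contra! h
    exact hx ⟨fun j => (h j).1, fun j => (h j).2.le⟩
  obtain ⟨j, hj⟩ := hj
  refine Finset.sum_eq_zero fun i _ => ?_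
  rw [Finset.prod_eq_zero (Finset.mem_univ j) (hist_eq_zero hb _ hj), mul_zero]

/-- If a product density vanishes outside the unit cube, its marginals live on `[0, 1)`. -/
lemma setIntegral_Ico_eq_one_of_prod {f : Fin d → ℝ → ℝ} (hf : ∀ j, IsPdf (f j))
    (h0 : ∀ᵐ x : Fin d → ℝ, x ∉ Set.Icc (0 : Fin d → ℝ) 1 → ∏ j, f j (x j) = 0) (j : Fin d) :
    ∫ t in Set.Ico (0 : ℝ) 1, f j t = 1 := by
  rw [← integral_Icc_eq_integral_Ico]
  -- Numbers in `[0, 1]` whose product is one are all equal to one.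
  have h1 : ∏ j, ∫ t in Set.Icc (0 : ℝ) 1, f j t = 1 := by
    refine Eq.trans ?_ (IsPdf.fintype_prod hf).integral_eq_one
    rw [Finset.prod_congr rfl fun j _ => (integral_indicator (f := f j)
      (measurableSet_Icc (a := (0 : ℝ)) (b := 1))).symm]
    rw [← integral_fintype_prod_volume_eq_prod]
    refine integral_congr_ae ?_
    filter_upwards [h0] with x hx
    by_cases h : x ∈ Set.Icc (0 : Fin d → ℝ) 1
    · exact Finset.prod_congr rfl fun j _ =>
        Set.indicator_of_mem (show x j ∈ Set.Icc (0 : ℝ) 1 from ⟨h.1 j, h.2 j⟩) _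
    · rw [hx h]
      have hj : ∃ j, x j ∉ Set.Icc (0 : ℝ) 1 := by
        by_contra! h'
        exact h ⟨fun j => (h' j).1, fun j => (h' j).2⟩
      obtain ⟨j, hj⟩ := hj
      exact Finset.prod_eq_zero (Finset.mem_univ j) (Set.indicator_of_notMem hj _)
  have hnn : ∀ j, 0 ≤ ∫ t in Set.Icc (0 : ℝ) 1, f j t := fun j =>
    setIntegral_nonneg_of_ae (hf j).nonneg
  have hle : ∀ j, ∫ t in Set.Icc (0 : ℝ) 1, f j t ≤ 1 := fun j =>
    (hf j).integral_eq_one ▸ setIntegral_le_integral (hf j).integrable (hf j).nonneg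
  refine le_antisymm (hle j) ?_
  rw [← Finset.mul_prod_erase _ _ (Finset.mem_univ j)] at h1
  refine h1.symm.le.trans ?_
  exact mul_le_of_le_one_right (hnn j) (Finset.prod_le_one (fun i _ => hnn i) fun i _ => hle i)

/-- Densities with a Lipschitz spectrum are close to low-rank histograms with parameters on a
fine grid. -/
lemma exists_gridMixture_integral_abs_sub_le (hb : 0 < b) (hk : 0 < k) (hm : 0 < m)
    {p : (Fin d → ℝ) → ℝ} (hp : p ∈ unitCubePdfs d) {w : ℕ → ℝ} {L : ℕ → ℝ≥0}
    (hspec : HasNLSpectrum p w L) :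
    ∃ θ : GridParameters d b k m,
      ∫ x, |p x - gridMixture θ x| ≤
        d / (Real.sqrt 12 * b) * ∑ i ∈ Finset.range k, w i * L i + 2 * ∑' i, w (k + i)
          + (2 * b * d + 2 * k) / m := by
  obtain ⟨hw, -, hw1, q, hq, hpq⟩ := hspec
  have : NeZero b := ⟨hb.ne'⟩
  let f : ℕ → (Fin d → ℝ) → ℝ := fun i x => ∏ j, q i j (x j)
  have hf : ∀ i, IsPdf (f i) := fun i => IsPdf.fintype_prod fun j => (hq i j).1
  have hf0 : ∀ᵐ x, ∀ i, 0 ≤ w i * f i x := by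
    filter_upwards [ae_all_iff.mpr fun i => (hf i).nonneg] with x hx i
    exact mul_nonneg (hw i) (hx i)
  -- All terms being non-negative, `w i * f i ≤ p` almost everywhere, so a component of positive
  -- weight vanishes outside the cube with `p`. Components of weight zero may live anywhere; they
  -- get an arbitrary grid point below.
  have hsupp : ∀ i, 0 < w i → ∀ j, ∫ t in Set.Ico (0 : ℝ) 1, q i j t = 1 := by
    intro i hi
    refine setIntegral_Ico_eq_one_of_prod (fun j => (hq i j).1) ?_
    filter_upwards [hf0, hpq, hp.2] with x h1 h2 h3 hx
    have h4 := le_hasSum h2 i fun j _ => h1 j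
    rw [h3 hx] at h4
    have h5 : w i * f i x = 0 := le_antisymm h4 (h1 i)
    exact (mul_eq_zero.mp h5).resolve_left hi.ne'
  have hg : ∀ i j, ∃ g : SimplexGrid b m, 0 < w i →
      ∫ t, |q i j t - hist g.toVec t| ≤ L i / (Real.sqrt 12 * b) + 2 * b / m := by
    intro i j
    by_cases hi : 0 < w i
    · obtain ⟨g, hg⟩ := exists_grid_hist_integral_abs_sub_le hb hm (hq i j).1 (hq i j).2
        (hsupp i hi j)
      exact ⟨g, fun _ => hg⟩
    · exact ⟨Classical.arbitrary _, fun h => absurd h hi⟩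
  choose g hg using hg
  set T := ∑' i, w (k + i) with hT
  have hsum : ∑ i : Fin k, w i + T = 1 := by
    rw [Fin.sum_univ_eq_sum_range w k, hT, ← hw1.tsum_eq, ← hw1.summable.sum_add_tsum_nat_add k]
    simp_rw [add_comm]
  have hT0 : 0 ≤ T := tsum_nonneg fun i => hw _
  let z : Fin k := ⟨0, hk⟩
  -- The truncated weights sum to `1 - T`; putting `T` on component `z` restores a probability
  -- vector. This costs `T` beside the truncation error `T`, whence the factor 2.
  let v : Fin k → ℝ := fun i => w i + if i = z then T else 0
  have hv : v ∈ stdSimplex ℝ (Fin k) := by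
    refine ⟨fun i => add_nonneg (hw _) (by split_ifs <;> simp [hT0]), ?_⟩
    simp only [v, Finset.sum_add_distrib, Finset.sum_ite_eq', Finset.mem_univ, if_true]
    exact hsum
  obtain ⟨u, hu⟩ := SimplexGrid.exists_sum_abs_sub_le hk hm hv
  refine ⟨(u, fun i j => g i j), ?_⟩
  have hwf : Integrable fun x => ∑ i : Fin k, w i * f i x :=
    integrable_finsetSum _ fun i _ => (hf i).integrable.const_mul _
  have htrunc : ∫ x, |p x - ∑ i : Fin k, w i * f i x| = T := by
    have h1 : ∫ x, |p x - ∑ i : Fin k, w i * f i x| = ∫ x, (p x - ∑ i : Fin k, w i * f i x) := by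
      refine integral_congr_ae ?_
      filter_upwards [hf0, hpq] with x h1 h2
      refine abs_of_nonneg (sub_nonneg.mpr ?_)
      rw [Fin.sum_univ_eq_sum_range (fun i => w i * f i x) k]
      exact sum_le_hasSum _ (fun i _ => h1 i) h2
    rw [h1, integral_sub hp.1.integrable hwf, hp.1.integral_eq_one,
      integral_finsetSum _ fun (i : Fin k) _ => (hf i).integrable.const_mul (w i)]
    simp_rw [integral_const_mul, fun i => (hf i).integral_eq_one, mul_one]
    linarith
  have hG : ∀ i : Fin k, IsPdf fun x : Fin d → ℝ => ∏ j, hist (g i j).toVec (x j) := fun i =>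
    IsPdf.fintype_prod fun j => isPdf_hist hb ((g i j).toVec_mem hm)
  have hmix := integral_abs_sum_sub_sum_le (w := fun i : Fin k => w i) (v := u.toVec)
    (fun i => hw i) (fun i : Fin k => hf i) hG
  have hweights : ∑ i : Fin k, |w i - u.toVec i| ≤ T + 2 * k / m := by
    have h1 : ∑ i : Fin k, |w i - u.toVec i|
        ≤ ∑ i : Fin k, (|w i - v i| + |v i - u.toVec i|) :=
      Finset.sum_le_sum fun i _ => abs_sub_le _ _ _
    have h2 : ∑ i : Fin k, |w i - v i| = T := by
      simp only [v, sub_add_cancel_left, abs_neg, apply_ite (fun r : ℝ => |r|), abs_zero,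
        Finset.sum_ite_eq', Finset.mem_univ, if_true, abs_of_nonneg hT0]
    rw [Finset.sum_add_distrib, h2] at h1
    linarith
  have hcomp : ∑ i : Fin k, w i * (∫ x, |f i x - ∏ j, hist (g i j).toVec (x j)|)
      ≤ d / (Real.sqrt 12 * b) * ∑ i ∈ Finset.range k, w i * L i + 2 * b * d / m := by
    have h1 : ∀ i : Fin k, w i * (∫ x, |f i x - ∏ j, hist (g i j).toVec (x j)|)
        ≤ w i * (d * (L i / (Real.sqrt 12 * b) + 2 * b / m)) := by
      intro i
      rcases (hw i).eq_or_lt with h | h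
      · simp [← h]
      · refine mul_le_mul_of_nonneg_left ?_ h.le
        refine (integral_abs_prod_sub_prod_le (fun j => (hq i j).1)
          fun j => isPdf_hist hb ((g i j).toVec_mem hm)).trans ?_
        exact (Finset.sum_le_sum fun j _ => hg i j h).trans (by simp [mul_add])
    have h2 : ∑ i : Fin k, w i * (d * (L i / (Real.sqrt 12 * b) + 2 * b / m))
        = d / (Real.sqrt 12 * b) * ∑ i ∈ Finset.range k, w i * L i
          + (∑ i : Fin k, w i) * (2 * b * d / m) := by
      rw [← Fin.sum_univ_eq_sum_range (fun i => w i * (L i : ℝ)) k, Finset.mul_sum,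
        Finset.sum_mul, ← Finset.sum_add_distrib]
      exact Finset.sum_congr rfl fun i _ => by ring
    refine (Finset.sum_le_sum fun i _ => h1 i).trans (h2.le.trans ?_)
    gcongr
    exact mul_le_of_le_one_left (by positivity) (by linarith)
  have htri := integral_abs_sub_le_add hp.1.integrable hwf
    (isPdf_gridMixture hb hm (u, fun (i : Fin k) j => g i j)).integrable
  refine htri.trans ?_
  rw [htrunc]
  simp only [gridMixture]
  rw [add_div]
  linarith

lemma card_gridParameters_le :
    Fintype.card (GridParameters d b k m)
      ≤ (m + 1) ^ (k + b * d * k) := by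
  change Fintype.card (SimplexGrid k m × (Fin k → Fin d → SimplexGrid b m)) ≤ _
  rw [Fintype.card_prod, Fintype.card_fun, Fintype.card_fun, Fintype.card_fin, Fintype.card_fin,
    pow_add, pow_mul, pow_mul]
  gcongr <;> exact SimplexGrid.card_le

end Approximation

/-! ### Numerical bounds -/

section Numerics

lemma log_four_mul_ge {N : ℝ} (hN : 1 ≤ N) : (8 / 9 : ℝ) ≤ Real.log (4 * N) := by
  have h1 : Real.log 4 ≤ Real.log (4 * N) := Real.log_le_log (by norm_num) (by linarith)
  have h2 : Real.log 4 = 2 * Real.log 2 := by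
    rw [show (4 : ℝ) = 2 ^ 2 by norm_num, Real.log_pow]
    norm_num
  linarith [Real.log_two_gt_d9]

/-- The discretization error is dominated by the estimation error. -/
lemma discretization_le_sqrt {B d k n : ℝ} (hB : 1 ≤ B) (hd : 1 ≤ d) (hk : 1 ≤ k) (hn : 1 ≤ n) :
    (2 * B * d + 2 * k) / (4 * B * d * k * n - 1)
      ≤ Real.sqrt (2 * B * d * k * Real.log (4 * B * d * k * n) / n) := by
  have hBd : 1 ≤ B * d := one_le_mul_of_one_le_of_one_le hB hd
  have hN1 : 1 ≤ B * d * k := one_le_mul_of_one_le_of_one_le hBd hk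
  have hN : 1 ≤ B * d * k * n := one_le_mul_of_one_le_of_one_le hN1 hn
  have hlog := log_four_mul_ge hN
  rw [show 4 * (B * d * k * n) = 4 * B * d * k * n by ring] at hlog
  have hnum : 2 * B * d + 2 * k ≤ 4 * (B * d * k) := by
    nlinarith [mul_le_mul_of_nonneg_left hk (by linarith : (0 : ℝ) ≤ B * d),
      mul_le_mul_of_nonneg_right hBd (by linarith : (0 : ℝ) ≤ k)]
  -- The denominator is at least `3 * B * d * k * n`. The square `16 / 9` of `4 / 3` is where the
  -- bound `8 / 9` on the logarithm comes from.
  have h1 : (2 * B * d + 2 * k) / (4 * B * d * k * n - 1) ≤ 4 / (3 * n) := by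
    rw [div_le_div_iff₀ (by nlinarith) (by linarith)]
    nlinarith [mul_le_mul_of_nonneg_right hnum (by linarith : (0 : ℝ) ≤ n)]
  refine h1.trans (Real.le_sqrt_of_sq_le ?_)
  have h2 : (16 / 9 : ℝ) ≤ 2 * B * d * k * Real.log (4 * B * d * k * n) := by
    nlinarith [mul_le_mul hN1 hlog (by norm_num) (by linarith)]
  calc (4 / (3 * n)) ^ 2 = 16 / 9 / n / n := by field_simp; norm_num
    _ ≤ 16 / 9 / n := div_le_self (by positivity) hn
    _ ≤ _ := by gcongr

/-- The union bound over all pairs of grid parameters is below the confidence level. -/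
lemma sq_card_mul_exp_lt {B d k n δ C : ℝ} (hB : 1 ≤ B) (hd : 1 ≤ d) (hk : 1 ≤ k) (hn : 1 ≤ n)
    (hδ₀ : 0 < δ) (hδ₁ : δ ≤ 1) (hC0 : 0 ≤ C)
    (hC : C ≤ Real.exp (2 * B * d * k * Real.log (4 * B * d * k * n))) :
    C ^ 2 * (2 * Real.exp (-2 * n * (Real.sqrt (2 * B * d * k * Real.log (4 * B * d * k * n) / n)
      + Real.sqrt (Real.log (3 / δ) / (2 * n))) ^ 2)) < δ := by
  have hN1 : 1 ≤ B * d * k :=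
    one_le_mul_of_one_le_of_one_le (one_le_mul_of_one_le_of_one_le hB hd) hk
  have hlog := log_four_mul_ge (one_le_mul_of_one_le_of_one_le hN1 hn)
  rw [show 4 * (B * d * k * n) = 4 * B * d * k * n by ring] at hlog
  set l := Real.log (4 * B * d * k * n)
  have hlδ : 0 ≤ Real.log (3 / δ) :=
    Real.log_nonneg (by rw [le_div_iff₀ hδ₀]; linarith)
  have hA : 0 ≤ 2 * B * d * k * l := by
    have : 0 ≤ B * d * k * l := mul_nonneg (by linarith) (by linarith)
    linarith
  have hs1 := Real.sq_sqrt (div_nonneg hA (by linarith : (0 : ℝ) ≤ n))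
  have hs2 := Real.sq_sqrt (div_nonneg hlδ (by linarith : (0 : ℝ) ≤ 2 * n))
  have hp1 := Real.sqrt_nonneg (2 * B * d * k * l / n)
  have hp2 := Real.sqrt_nonneg (Real.log (3 / δ) / (2 * n))
  set s₁ := Real.sqrt (2 * B * d * k * l / n)
  set s₂ := Real.sqrt (Real.log (3 / δ) / (2 * n))
  have hn0 : n ≠ 0 := by linarith
  have e1 : n * s₁ ^ 2 = 2 * B * d * k * l := by rw [hs1]; field_simp
  have e2 : 2 * n * s₂ ^ 2 = Real.log (3 / δ) := by rw [hs2]; field_simp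
  -- Dropping the cross term splits the exponent: the `s₁` part cancels `C ^ 2` and the `s₂` part
  -- gives `δ / 3`, so the two tails sum to `2 * (δ / 3) < δ`.
  have hexp : -2 * n * (s₁ + s₂) ^ 2 ≤ -(2 * (2 * B * d * k * l)) - Real.log (3 / δ) := by
    have : 0 ≤ n * (s₁ * s₂) := mul_nonneg (by linarith) (mul_nonneg hp1 hp2)
    nlinarith
  calc C ^ 2 * (2 * Real.exp (-2 * n * (s₁ + s₂) ^ 2))
      ≤ Real.exp (2 * B * d * k * l) ^ 2 *
        (2 * Real.exp (-(2 * (2 * B * d * k * l)) - Real.log (3 / δ))) := by gcongr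
    _ = 2 * (δ / 3) := by
        rw [Real.exp_sub, Real.exp_log (by positivity), Real.exp_neg, two_mul (2 * B * d * k * l),
          Real.exp_add]
        have := Real.exp_pos (2 * B * d * k * l)
        field_simp
    _ < δ := by linarith

end Numerics

end

/-! ### The estimator and its error bound -/

theorem theorem2 (d b k n : ℕ) (hd : 0 < d) (hb : 0 < b) (hk : 0 < k) (hn : 0 < n)
    (δ : ℝ) (hδ₀ : 0 < δ) (hδ₁ : δ ≤ 1) :
    ∃ V : (Fin n → (Fin d → ℝ)) → ((Fin d → ℝ) → ℝ),
      Measurable (fun z : (Fin n → (Fin d → ℝ)) × (Fin d → ℝ) => V z.1 z.2) ∧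
      (∀ s, V s ∈ unitCubePdfs d) ∧
      (∀ s, V s ∈ lowRankHistograms d b k) ∧
      ∀ p ∈ unitCubePdfs d, ∀ (w : ℕ → ℝ) (L : ℕ → ℝ≥0), HasNLSpectrum p w L →
        ∀ (Ω : Type*) [MeasurableSpace Ω] (P : Measure Ω) [IsProbabilityMeasure P]
          (X : Fin n → Ω → (Fin d → ℝ)),
          (∀ i, HasLaw (X i) (densityMeasure p) P) → iIndepFun X P →
          P.real {ω | ∫ x, |p x - V (fun i => X i ω) x| >
              Real.sqrt 3 * d / (2 * b) * ∑ i ∈ Finset.range k, w i * L i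
                + 6 * ∑' i, w (k + i)
                + 7 * Real.sqrt (2 * b * d * k * Real.log (4 * b * d * k * n) / n)
                + 7 * Real.sqrt (Real.log (3 / δ) / (2 * n))} < δ := by
  -- A grid coordinate takes `m + 1` values, so this choice makes the logarithm in the cardinality
  -- bound exactly the one in the statement.
  obtain ⟨m, hm⟩ : ∃ m, m + 1 = 4 * b * d * k * n :=
    ⟨4 * b * d * k * n - 1, Nat.sub_add_cancel (Nat.succ_le_of_lt (by positivity))⟩
  have hm0 : 0 < m := by
    have : 0 < b * d * k * n := by positivity
    nlinarith
  have : NeZero b := ⟨hb.ne'⟩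
  have : NeZero k := ⟨hk.ne'⟩
  have hd1 : (1 : ℝ) ≤ d := by exact_mod_cast hd
  have hb1 : (1 : ℝ) ≤ b := by exact_mod_cast hb
  have hk1 : (1 : ℝ) ≤ k := by exact_mod_cast hk
  have hn1 : (1 : ℝ) ≤ n := by exact_mod_cast hn
  have hmR : (m : ℝ) + 1 = 4 * b * d * k * n := by exact_mod_cast hm
  have hcard : (Fintype.card (GridParameters d b k m) : ℝ)
      ≤ Real.exp (2 * b * d * k * Real.log (4 * b * d * k * n)) := by
    have h1 : Fintype.card (GridParameters d b k m) ≤ (m + 1) ^ (2 * b * d * k) := by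
      refine card_gridParameters_le.trans (Nat.pow_le_pow_right (Nat.succ_pos m) ?_)
      have : 1 ≤ b * d := Nat.mul_pos hb hd
      nlinarith
    have h2 : ((m + 1 : ℕ) : ℝ) ^ (2 * b * d * k)
        = Real.exp (2 * b * d * k * Real.log (4 * b * d * k * n)) := by
      rw [← hmR, mul_comm (2 * (b : ℝ) * d * k), Real.exp_mul, Real.exp_log (by positivity)]
      rw [← Real.rpow_natCast]
      push_cast
      rfl
    rw [← h2]
    exact_mod_cast h1
  obtain ⟨g, hgm, hg⟩ := exists_measurable_selector (ι := GridParameters d b k m) gridMixture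
    (isPdf_gridMixture hb hm0) measurable_gridMixture n hn
  refine ⟨fun s => gridMixture (g s), ?_, fun s => gridMixture_mem_unitCubePdfs hb hm0 _,
    fun s => gridMixture_mem_lowRankHistograms hb hm0 _, ?_⟩
  · exact hgm.gridMixture
  intro p hp w L hspec Ω _ P _ X hX hind
  obtain ⟨θ, hθ⟩ := exists_gridMixture_integral_abs_sub_le (b := b) hb hk hm0 hp hspec
  have hdisc := discretization_le_sqrt hb1 hd1 hk1 hn1
  rw [← hmR, add_sub_cancel_right, hmR] at hdisc
  have hsmall := sq_card_mul_exp_lt hb1 hd1 hk1 hn1 hδ₀ hδ₁ (Nat.cast_nonneg _) hcard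
  have hr₁ := Real.sqrt_nonneg (2 * b * d * k * Real.log (4 * b * d * k * n) / n)
  have hr₂ := Real.sqrt_nonneg (Real.log (3 / δ) / (2 * n))
  generalize Real.sqrt (2 * b * d * k * Real.log (4 * b * d * k * n) / n) = r₁ at hsmall hdisc hr₁ ⊢
  generalize Real.sqrt (Real.log (3 / δ) / (2 * n)) = r₂ at hsmall hr₂ ⊢
  have hprob := hg p hp.1 Ω P X hX hind (r₁ + r₂) (add_nonneg hr₁ hr₂)
  refine lt_of_le_of_lt (le_trans (measureReal_mono ?_) hprob) hsmall
  intro ω hω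
  -- Tripling the approximation error of `θ` turns `1 / √12` into `√3 / 2` and the tail factor 2
  -- into 6; the rest is at most `7 r₁ + 4 r₂`, below the stated `7 r₁ + 7 r₂`.
  refine ⟨θ, lt_of_le_of_lt ?_ hω⟩
  have h12 : Real.sqrt 12 = 2 * Real.sqrt 3 := by
    rw [show (12 : ℝ) = 2 ^ 2 * 3 by norm_num, Real.sqrt_mul (by norm_num),
      Real.sqrt_sq (by norm_num)]
  have hcoef : 3 * (d / (Real.sqrt 12 * b)) = Real.sqrt 3 * d / (2 * b) := by
    have h3 := Real.mul_self_sqrt (show (0 : ℝ) ≤ 3 by norm_num)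
    rw [h12]
    field_simp
    nlinarith
  rw [← hcoef]
  linarith
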